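/- Let $d,K$ be dimensions, $(\Omega,\mathcal F,\mathbb P)$ a probability space and $\{\mathcal F_t\}_{t\ge1}$ a filtration. Let $\{X_t\}_{t\ge1}$ be a stochastic process with values in $\mathbb R^{d\times K}$ such that $X_t$ is $\mathcal F_t$-measurable and, for some constant $B>0$, the columns $x_{ti}$ of $X_t$ satisfy $\|x_{ti}\|_2\le B$ almost surely. Let $\{\epsilon_t\}_{t\ge1}$ be a martingale difference process with values in $\mathbb R^K$, that is, $\epsilon_t$ is $\mathcal F_{t+1}$-measurable and $\mathbb E[\epsilon_t\mid\mathcal F_t]=0$, such that $\|\epsilon_t\|_1\le2$ almost surely, and let $\Sigma_t=\mathbb E[\epsilon_t\epsilon_t^\top\mid\mathcal F_t]$ be its conditional covariance. Let $H_0\in\mathbb R^{d\times d}$ be a deterministic symmetric matrix with $\lambda_{\min}(H_0)>\lambda$ for some $\lambda>0$. For $t\ge1$ define $$S_t=\sum_{s=1}^{t-1}X_s\epsilon_s,\qquad H_t=H_0+\sum_{s=1}^{t-1}X_s\Sigma_sX_s^\top .$$ Then, for every $\delta\in(0,1]$, with probability at least $1-\delta$, simultaneously for all $t\ge1$, $$\|S_t\|_{H_t^{-1}}\le\frac{\sqrt\lambda}{4B}+\frac{4B}{\sqrt\lambda}\log\left(\frac{\det(H_t)^{1/2}}{\delta\lambda^{d/2}}\right)+\frac{4B}{\sqrt\lambda}\,d\log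 2,$$ where $\|x\|_W=\sqrt{x^\top Wx}$. In particular, for $B=1$ the right-hand side is $\frac{\sqrt\lambda}{4}+\frac{4}{\sqrt\lambda}\log\left(\frac{\det(H_t)^{1/2}}{\delta\lambda^{d/2}}\right)+\frac{4}{\sqrt\lambda}d\log 2$. -/

import Mathlib

open MeasureTheory ProbabilityTheory Filter
open scoped Matrix

noncomputable section

/-- The Euclidean norm weighted by `W`, that is `√(xᵀ W x)`. -/
def weightedNorm {d : ℕ} (W : Matrix (Fin d) (Fin d) ℝ) (x : Fin d → ℝ) : ℝ :=
  Real.sqrt (x ⬝ᵥ (W *ᵥ x))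

/-- The conditional second moment matrix `E[e eᵀ | m]`, taken entrywise. For a random vector with
zero conditional mean it is the conditional covariance matrix. -/
def condCov {Ω : Type*} {mΩ : MeasurableSpace Ω} (μ : Measure Ω) (m : MeasurableSpace Ω) {K : ℕ}
    (e : Ω → Fin K → ℝ) (ω : Ω) : Matrix (Fin K) (Fin K) ℝ :=
  Matrix.of fun i j => (μ[fun ω' => e ω' i * e ω' j | m]) ω

/-- `S_t = ∑_{s=1}^{t-1} X_s ε_s`. -/
def noiseSum {Ω : Type*} {d K : ℕ} (X : ℕ → Ω → Matrix (Fin d) (Fin K) ℝ)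
    (ε : ℕ → Ω → Fin K → ℝ) (t : ℕ) (ω : Ω) : Fin d → ℝ :=
  ∑ s ∈ Finset.Ico 1 t, X s ω *ᵥ ε s ω

/-- `H_t = H₀ + ∑_{s=1}^{t-1} X_s Σ_s X_sᵀ`. -/
def infoMatrix {Ω : Type*} {d K : ℕ} (H₀ : Matrix (Fin d) (Fin d) ℝ)
    (X : ℕ → Ω → Matrix (Fin d) (Fin K) ℝ) (Sig : ℕ → Ω → Matrix (Fin K) (Fin K) ℝ)
    (t : ℕ) (ω : Ω) : Matrix (Fin d) (Fin d) ℝ :=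
  H₀ + ∑ s ∈ Finset.Ico 1 t, X s ω * Sig s ω * (X s ω)ᵀ

end

/-!
The proof is the method of mixtures with a truncated Gaussian prior. For a fixed vector `ξ` of Euclidean
norm at most `r = 1 / (2 * B)`, the increments `Y = ξᵀ X_t ε_t` satisfy `|Y| ≤ 1`, so that
`exp y ≤ 1 + y + y²` on `[-1, 1]` makes `exp (ξᵀ S_t - ξᵀ H_t ξ)` a nonnegative supermartingale
(`lintegral_mul_exp_sub_quadForm_le`). By Tonelli the same holds for its integral `L_t` over the ball of
radius `r` (`setLIntegral_expQuadMixture_succ_le`). Since `H₀ ≥ lam`, the initial value `L_1` is at most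
`N`, the integral of `exp (-lam |ξ|²)` over the ball, and Ville's inequality
(`mul_measure_exists_le_le_lintegral`) gives `L_t < N / δ` for all `t` outside an event of probability at
most `δ`.

Conversely `L_t` is large when `S_t` is: shifting the integration variable by the multiple `x` of
`H_t⁻¹ S_t` with `xᵀ H_t x = a²`, `a = r √lam / 2 = √lam / (4 * B)`, removing the linear term by symmetry
and changing variables by a square root of `H_t` give
`L_t ≥ exp (a ‖S_t‖ - a²) (√lam / 2)^d / √(det H_t) * N`, the norm being weighted by `H_t⁻¹`
(`Matrix.IsHermitian.exp_weightedNorm_inv_mul_lintegral_le`). The factor `N` cancels, and taking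
logarithms gives the bound.
-/

/-! ### Gaussian integrals over balls -/

theorem Matrix.IsHermitian.mul_dotProduct_self_le {n : Type*} [Fintype n] [DecidableEq n]
    {H : Matrix n n ℝ} (hH : H.IsHermitian) {c : ℝ} (hc : ∀ i, c ≤ hH.eigenvalues i)
    (u : n → ℝ) : c * (u ⬝ᵥ u) ≤ u ⬝ᵥ (H *ᵥ u) := by
  have h : (H - algebraMap ℝ (Matrix n n ℝ) c).PosSemidef := by
    refine Matrix.posSemidef_iff_isHermitian_and_spectrum_nonneg.2 ⟨?_, ?_⟩
    · refine hH.sub ?_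
      rw [Matrix.algebraMap_eq_diagonal]
      exact Matrix.isHermitian_diagonal _
    · rw [← spectrum.sub_singleton_eq, hH.spectrum_real_eq_range_eigenvalues]
      rintro _ ⟨_, ⟨i, rfl⟩, _, rfl, rfl⟩
      exact sub_nonneg.2 (hc i)
  have h1 := h.dotProduct_mulVec_nonneg u
  rw [Matrix.sub_mulVec, dotProduct_sub, Algebra.algebraMap_eq_smul_one, Matrix.smul_mulVec,
    Matrix.one_mulVec, dotProduct_smul, smul_eq_mul, star_trivial] at h1
  linarith

theorem Matrix.IsHermitian.posDef_of_mul_dotProduct_self_le {n : Type*} [Fintype n]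
    {H : Matrix n n ℝ} (hH : H.IsHermitian) {c : ℝ} (hc : 0 < c)
    (hle : ∀ u, c * (u ⬝ᵥ u) ≤ u ⬝ᵥ (H *ᵥ u)) : H.PosDef := by
  refine .of_dotProduct_mulVec_pos hH fun u hu => ?_
  have : 0 < u ⬝ᵥ u := by simpa using Matrix.dotProduct_star_self_pos_iff.2 hu
  exact (mul_pos hc this).trans_le (hle u)

open scoped MatrixOrder in
theorem Matrix.PosDef.exists_transpose_mul_self {n : Type*} [Fintype n] [DecidableEq n]
    {H : Matrix n n ℝ} (hH : H.PosDef) : ∃ P : Matrix n n ℝ, Pᵀ * P = H ∧ |P.det| = √H.det := by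
  obtain ⟨P, hP⟩ := CStarAlgebra.nonneg_iff_eq_star_mul_self.mp hH.posSemidef.nonneg
  have hP' : H = Pᵀ * P := by simpa [Matrix.star_eq_conjTranspose] using hP
  refine ⟨P, hP'.symm, ?_⟩
  rw [hP', Matrix.det_mul, Matrix.det_transpose, Real.sqrt_mul_self_eq_abs]

/-- Substituting `w = (2 / √c) P u` with `H = Pᵀ P` turns the isotropic Gaussian integral over the ball
of radius `r` into an integral of `exp (-4 uᵀ H u)` over an ellipsoid. The factor `2` shrinks the
ellipsoid enough for two of its points to have their sum in the ball. -/
theorem Matrix.PosDef.ofReal_mul_lintegral_le {n : Type*} [Fintype n] [DecidableEq n]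
    {H : Matrix n n ℝ} (hH : H.PosDef) {c : ℝ} (hc : 0 < c) (r : ℝ) :
    ENNReal.ofReal ((√c / 2) ^ Fintype.card n / √H.det) *
        ∫⁻ w in {w : n → ℝ | w ⬝ᵥ w ≤ r ^ 2}, ENNReal.ofReal (Real.exp (-(c * (w ⬝ᵥ w)))) ≤
      ∫⁻ u in {u : n → ℝ | 4 * (u ⬝ᵥ (H *ᵥ u)) ≤ c * r ^ 2},
        ENNReal.ofReal (Real.exp (-(u ⬝ᵥ (H *ᵥ u)))) := by
  obtain ⟨P, hP, hdet⟩ := hH.exists_transpose_mul_self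
  have hsc : 0 < √c := Real.sqrt_pos.2 hc
  have hHdet : 0 < √H.det := Real.sqrt_pos.2 hH.det_pos
  set M : Matrix n n ℝ := (2 / √c) • P with hM
  have hMdet : |M.det| = (2 / √c) ^ Fintype.card n * √H.det := by
    rw [hM, Matrix.det_smul, abs_mul, hdet, abs_of_pos (by positivity)]
  have hM0 : M.det ≠ 0 := by
    rw [← abs_pos, hMdet]; positivity
  have hquad : ∀ u, (M *ᵥ u) ⬝ᵥ (M *ᵥ u) = 4 / c * (u ⬝ᵥ (H *ᵥ u)) := by
    intro u
    rw [hM, Matrix.smul_mulVec, smul_dotProduct, dotProduct_smul, ← hP, ← Matrix.mulVec_mulVec,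
      Matrix.dotProduct_mulVec u, Matrix.vecMul_transpose, smul_eq_mul, smul_eq_mul, ← mul_assoc,
      div_mul_div_comm, Real.mul_self_sqrt hc.le]
    norm_num
  have hms : MeasurableSet {w : n → ℝ | w ⬝ᵥ w ≤ r ^ 2} :=
    (isClosed_le (by fun_prop) (by fun_prop)).measurableSet
  have hmsH : MeasurableSet {u : n → ℝ | 4 * (u ⬝ᵥ (H *ᵥ u)) ≤ c * r ^ 2} :=
    (isClosed_le (by fun_prop) (by fun_prop)).measurableSet
  have hg : Measurable fun w : n → ℝ => ENNReal.ofReal (Real.exp (-(c * (w ⬝ᵥ w)))) :=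
    (ENNReal.continuous_ofReal.comp (by fun_prop)).measurable
  have hcoef : (√c / 2) ^ Fintype.card n / √H.det = |M.det⁻¹| := by
    rw [abs_inv, hMdet, mul_inv, ← inv_pow, inv_div, div_eq_mul_inv]
  rw [hcoef, ← lintegral_indicator hms, ← lintegral_indicator hmsH, ← smul_eq_mul,
    ← lintegral_smul_measure, ← Real.map_matrix_volume_pi_eq_smul_volume_pi hM0,
    lintegral_map (hg.indicator hms) (LinearMap.continuous_of_finiteDimensional _).measurable]
  refine lintegral_mono fun u => ?_
  simp only [Matrix.toLin'_apply, Set.indicator_apply, Set.mem_ofPred_eq, hquad]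
  have hq : 0 ≤ u ⬝ᵥ (H *ᵥ u) := by simpa using hH.posSemidef.dotProduct_mulVec_nonneg u
  have hiff : 4 / c * (u ⬝ᵥ (H *ᵥ u)) ≤ r ^ 2 ↔ 4 * (u ⬝ᵥ (H *ᵥ u)) ≤ c * r ^ 2 := by
    rw [div_mul_eq_mul_div, div_le_iff₀ hc, mul_comm c]
  simp only [hiff]
  split_ifs
  · gcongr
    rw [← mul_assoc, mul_div_cancel₀ _ hc.ne']
    linarith
  · exact le_rfl

theorem Matrix.IsHermitian.dotProduct_mulVec_comm {n : Type*} [Fintype n] {H : Matrix n n ℝ}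
    (hH : H.IsHermitian) (x u : n → ℝ) : x ⬝ᵥ (H *ᵥ u) = u ⬝ᵥ (H *ᵥ x) := by
  have hT : Hᵀ = H := (Matrix.conjTranspose_eq_transpose_of_trivial H).symm.trans hH
  rw [Matrix.dotProduct_mulVec, ← Matrix.mulVec_transpose, hT, dotProduct_comm]

/-- A lower bound for the integral of `exp (ξᵀ S - ξᵀ H ξ)` over a ball by the value of the integrand at
a point `x`. Writing `ξ = x + u`, the linear term in `u` is removed by averaging over `u` and `-u`. -/
theorem Matrix.IsHermitian.lintegral_exp_shift_le {n : Type*} [Fintype n] {H : Matrix n n ℝ}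
    (hH : H.IsHermitian) {c r : ℝ} (hc : 0 < c)
    (hle : ∀ u, c * (u ⬝ᵥ u) ≤ u ⬝ᵥ (H *ᵥ u)) (S x : n → ℝ)
    (hx : 4 * (x ⬝ᵥ (H *ᵥ x)) ≤ c * r ^ 2) :
    ENNReal.ofReal (Real.exp (x ⬝ᵥ S - x ⬝ᵥ (H *ᵥ x))) *
        ∫⁻ u in {u : n → ℝ | 4 * (u ⬝ᵥ (H *ᵥ u)) ≤ c * r ^ 2},
          ENNReal.ofReal (Real.exp (-(u ⬝ᵥ (H *ᵥ u)))) ≤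
      ∫⁻ ξ in {ξ : n → ℝ | ξ ⬝ᵥ ξ ≤ r ^ 2},
        ENNReal.ofReal (Real.exp (ξ ⬝ᵥ S - ξ ⬝ᵥ (H *ᵥ ξ))) := by
  have hms : MeasurableSet {w : n → ℝ | w ⬝ᵥ w ≤ r ^ 2} :=
    (isClosed_le (by fun_prop) (by fun_prop)).measurableSet
  have hmsH : MeasurableSet {u : n → ℝ | 4 * (u ⬝ᵥ (H *ᵥ u)) ≤ c * r ^ 2} :=
    (isClosed_le (by fun_prop) (by fun_prop)).measurableSet
  set G : (n → ℝ) → ENNReal := {ξ : n → ℝ | ξ ⬝ᵥ ξ ≤ r ^ 2}.indicator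
    fun ξ => ENNReal.ofReal (Real.exp (ξ ⬝ᵥ S - ξ ⬝ᵥ (H *ᵥ ξ))) with hG
  have hGm : Measurable G :=
    (ENNReal.continuous_ofReal.comp (by fun_prop)).measurable.indicator hms
  have hexp : ∀ u, (x + u) ⬝ᵥ S - (x + u) ⬝ᵥ (H *ᵥ (x + u)) =
      (x ⬝ᵥ S - x ⬝ᵥ (H *ᵥ x)) + (-(u ⬝ᵥ (H *ᵥ u))) + (u ⬝ᵥ S - 2 * (x ⬝ᵥ (H *ᵥ u))) := by
    intro u
    simp only [Matrix.mulVec_add, add_dotProduct, dotProduct_add,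
      hH.dotProduct_mulVec_comm u x]
    ring
  -- Parallelogram law: `q (x + u) ≤ 2 q x + 2 q u` for `q u = uᵀ H u`.
  have hball : ∀ u, 4 * (u ⬝ᵥ (H *ᵥ u)) ≤ c * r ^ 2 → (x + u) ⬝ᵥ (x + u) ≤ r ^ 2 := by
    intro u hu
    have h1 := hle (x + u)
    have h2 := (mul_nonneg hc.le (by simpa using dotProduct_star_self_nonneg (x - u))).trans
      (hle (x - u))
    simp only [Matrix.mulVec_add, Matrix.mulVec_sub, add_dotProduct, dotProduct_add,
      sub_dotProduct, dotProduct_sub] at h1 h2 ⊢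
    refine le_of_mul_le_mul_left (h1.trans ?_) hc
    linarith
  have key : ∀ u, 2 * ({u : n → ℝ | 4 * (u ⬝ᵥ (H *ᵥ u)) ≤ c * r ^ 2}.indicator
      (fun u => ENNReal.ofReal (Real.exp (x ⬝ᵥ S - x ⬝ᵥ (H *ᵥ x))) *
        ENNReal.ofReal (Real.exp (-(u ⬝ᵥ (H *ᵥ u))))) u) ≤ G (x + u) + G (x + -u) := by
    intro u
    by_cases hu : 4 * (u ⬝ᵥ (H *ᵥ u)) ≤ c * r ^ 2
    · have hu' : 4 * ((-u) ⬝ᵥ (H *ᵥ (-u))) ≤ c * r ^ 2 := by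
        simpa [Matrix.mulVec_neg] using hu
      rw [hG, Set.indicator_of_mem (by exact hu), Set.indicator_of_mem (by exact hball u hu),
        Set.indicator_of_mem (by exact hball _ hu'), hexp, hexp,
        ← ENNReal.ofReal_mul (Real.exp_nonneg _), ← Real.exp_add,
        ← ENNReal.ofReal_add (Real.exp_nonneg _) (Real.exp_nonneg _),
        show (2 : ENNReal) = ENNReal.ofReal 2 by simp, ← ENNReal.ofReal_mul (by norm_num)]
      apply ENNReal.ofReal_le_ofReal
      simp only [Matrix.mulVec_neg, neg_dotProduct, dotProduct_neg, neg_neg]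
      set b := u ⬝ᵥ S - 2 * (x ⬝ᵥ (H *ᵥ u)) with hb
      have hb' : -(u ⬝ᵥ S) - 2 * -(x ⬝ᵥ (H *ᵥ u)) = -b := by rw [hb]; ring
      -- `exp b + exp (-b) ≥ 2`, from the tangent line of `exp` at `0`.
      rw [hb', Real.exp_add _ b, Real.exp_add _ (-b), ← mul_add]
      have := Real.add_one_le_exp b
      have := Real.add_one_le_exp (-b)
      rw [mul_comm]
      gcongr
      linarith
    · rw [Set.indicator_of_notMem (by exact hu)]
      simp
  have hneg : ∫⁻ u, G (x + -u) = ∫⁻ ξ, G ξ := by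
    rw [lintegral_neg_eq_self (fun u => G (x + u)), lintegral_add_left_eq_self]
  rw [← lintegral_const_mul' _ _ ENNReal.ofReal_ne_top, ← lintegral_indicator hms,
    ← lintegral_indicator hmsH,
    ← ENNReal.mul_le_mul_iff_right (a := 2) (by norm_num) (by norm_num),
    ← lintegral_const_mul' _ _ (by norm_num)]
  calc _ ≤ ∫⁻ u, G (x + u) + G (x + -u) := lintegral_mono key
    _ = 2 * ∫⁻ ξ, G ξ := by
      rw [lintegral_add_left (f := fun u => G (x + u))
        (hGm.comp (measurable_const_add x)), hneg,
        lintegral_add_left_eq_self, two_mul]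

/-- The integral of `exp (ξᵀ S - ξᵀ H ξ)` over the ball of radius `r` controls the weighted norm of `S`:
this is `Matrix.IsHermitian.lintegral_exp_shift_le` at the multiple `x` of `H⁻¹ S` which satisfies
`xᵀ H x = (r √c / 2)²`, or at `x = 0` if `S = 0`. -/
theorem Matrix.IsHermitian.exp_weightedNorm_inv_mul_lintegral_le {d : ℕ}
    {H : Matrix (Fin d) (Fin d) ℝ} (hH : H.IsHermitian) {c r : ℝ} (hc : 0 < c)
    (hle : ∀ u, c * (u ⬝ᵥ u) ≤ u ⬝ᵥ (H *ᵥ u)) (S : Fin d → ℝ) :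
    ENNReal.ofReal (Real.exp (r * √c / 2 * weightedNorm H⁻¹ S - (r * √c / 2) ^ 2) *
        ((√c / 2) ^ d / √H.det)) *
        ∫⁻ w in {w : Fin d → ℝ | w ⬝ᵥ w ≤ r ^ 2}, ENNReal.ofReal (Real.exp (-(c * (w ⬝ᵥ w)))) ≤
      ∫⁻ ξ in {ξ : Fin d → ℝ | ξ ⬝ᵥ ξ ≤ r ^ 2},
        ENNReal.ofReal (Real.exp (ξ ⬝ᵥ S - ξ ⬝ᵥ (H *ᵥ ξ))) := by
  have hpd := hH.posDef_of_mul_dotProduct_self_le hc hle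
  set a : ℝ := r * √c / 2 with ha
  set N := weightedNorm H⁻¹ S with hN
  have hNsq : N ^ 2 = S ⬝ᵥ (H⁻¹ *ᵥ S) := by
    rw [hN, weightedNorm, Real.sq_sqrt]
    simpa using hpd.inv.posSemidef.dotProduct_mulVec_nonneg S
  -- If `N = 0`, then `a / N = 0` and `x = 0`, which still satisfies the bounds below.
  set x : Fin d → ℝ := (a / N) • (H⁻¹ *ᵥ S) with hx
  have hHx : H *ᵥ x = (a / N) • S := by
    rw [hx, Matrix.mulVec_smul, Matrix.mulVec_mulVec,
      Matrix.mul_nonsing_inv _ hpd.det_pos.ne'.isUnit, Matrix.one_mulVec]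
  have hxS : x ⬝ᵥ S = a * N := by
    rw [hx, smul_dotProduct, dotProduct_comm, ← hNsq, smul_eq_mul]
    by_cases h0 : N = 0
    · simp [h0]
    · field_simp
  have hxH : x ⬝ᵥ (H *ᵥ x) ≤ a ^ 2 := by
    rw [hHx, dotProduct_smul, hxS, smul_eq_mul]
    by_cases h0 : N = 0
    · simp [h0, sq_nonneg]
    · apply le_of_eq; field_simp
  have hasq : 4 * a ^ 2 = c * r ^ 2 := by
    rw [ha, div_pow, mul_pow, Real.sq_sqrt hc.le]; ring
  refine le_trans ?_ (hH.lintegral_exp_shift_le hc hle S x (by linarith))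
  rw [ENNReal.ofReal_mul (Real.exp_nonneg _), mul_assoc]
  gcongr
  · linarith
  · simpa using hpd.ofReal_mul_lintegral_le hc r

theorem lintegral_exp_neg_dotProduct_pos {n : Type*} [Fintype n] (c : ℝ) {r : ℝ} (hr : 0 < r) :
    0 < ∫⁻ w in {w : n → ℝ | w ⬝ᵥ w ≤ r ^ 2}, ENNReal.ofReal (Real.exp (-(c * (w ⬝ᵥ w)))) := by
  have hm : Measurable fun w : n → ℝ => ENNReal.ofReal (Real.exp (-(c * (w ⬝ᵥ w)))) :=
    (ENNReal.continuous_ofReal.comp (by fun_prop)).measurable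
  rw [setLIntegral_pos_iff hm]
  have hop : IsOpen {w : n → ℝ | w ⬝ᵥ w < r ^ 2} := isOpen_lt (by fun_prop) (by fun_prop)
  refine (hop.measure_pos volume ⟨0, by simpa using by positivity⟩).trans_le (measure_mono ?_)
  intro w hw
  exact ⟨by simp [Function.mem_support, Real.exp_pos], show w ⬝ᵥ w ≤ r ^ 2 from le_of_lt hw⟩

theorem lintegral_exp_neg_dotProduct_ne_top {n : Type*} [Fintype n] {c : ℝ} (hc : 0 ≤ c) (r : ℝ) :
    ∫⁻ w in {w : n → ℝ | w ⬝ᵥ w ≤ r ^ 2}, ENNReal.ofReal (Real.exp (-(c * (w ⬝ᵥ w)))) ≠ ⊤ := by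
  have hsub : {w : n → ℝ | w ⬝ᵥ w ≤ r ^ 2} ⊆ Metric.closedBall 0 |r| := by
    intro w hw
    rw [mem_closedBall_zero_iff, pi_norm_le_iff_of_nonneg (abs_nonneg r)]
    intro i
    refine sq_le_sq.1 (le_trans ?_ hw)
    rw [sq]
    exact Finset.single_le_sum (f := fun i => w i * w i) (fun i _ => mul_self_nonneg _)
      (Finset.mem_univ i)
  have hfin : volume (Metric.closedBall (0 : n → ℝ) |r|) < ⊤ := measure_closedBall_lt_top
  refine ne_top_of_le_ne_top ((measure_mono hsub).trans_lt hfin).ne ?_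
  refine (lintegral_mono fun w => ?_).trans (setLIntegral_one _).le
  have : 0 ≤ w ⬝ᵥ w := by simpa using dotProduct_star_self_nonneg w
  simp only [ENNReal.ofReal_le_one, Real.exp_le_one_iff, Left.neg_nonpos_iff]
  positivity

/-! ### Ville's inequality -/

/-- Ville's maximal inequality for nonnegative supermartingales. The supermartingale property is stated
through integrals over events, which needs no integrability and passes through mixtures by Tonelli. -/
theorem mul_measure_exists_le_le_lintegral {Ω : Type*} {mΩ : MeasurableSpace Ω} {μ : Measure Ω}
    {ℱ : Filtration ℕ mΩ} {L : ℕ → Ω → ENNReal} {m : ℕ}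
    (hL : ∀ n, m ≤ n → Measurable[ℱ n] (L n))
    (hstep : ∀ n, m ≤ n → ∀ A, MeasurableSet[ℱ n] A →
      ∫⁻ ω in A, L (n + 1) ω ∂μ ≤ ∫⁻ ω in A, L n ω ∂μ) (c : ENNReal) :
    c * μ {ω | ∃ n, m ≤ n ∧ c ≤ L n ω} ≤ ∫⁻ ω, L m ω ∂μ := by
  -- `W n` is the event that the level `c` has not been reached strictly before time `n`.
  set W : ℕ → Set Ω := fun n => {ω | ∀ k, m ≤ k → k < n → L k ω < c} with hW
  have hWsucc : ∀ n, m ≤ n → W (n + 1) = W n ∩ {ω | L n ω < c} := by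
    intro n hn
    ext ω
    simp only [hW, Set.mem_ofPred_eq, Set.mem_inter_iff, Nat.lt_succ_iff_lt_or_eq]
    exact ⟨fun h => ⟨fun k hk hkn => h k hk (.inl hkn), h n hn (.inr rfl)⟩,
      fun h k hk hkn => hkn.elim (h.1 k hk) fun e => e ▸ h.2⟩
  have hWmeas : ∀ n, MeasurableSet[ℱ n] (W (n + 1)) := by
    intro n
    have : W (n + 1) = ⋂ k, ⋂ (_ : m ≤ k), ⋂ (_ : k < n + 1), {ω | L k ω < c} := by
      ext ω; simp [hW]
    rw [this]
    refine .iInter fun k => .iInter fun hk => .iInter fun hkn => ?_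
    exact ℱ.mono (Nat.lt_succ_iff.1 hkn) _ (measurableSet_lt (hL k hk) measurable_const)
  have hbound : ∀ n, m ≤ n → c * μ (W n)ᶜ + ∫⁻ ω in W n, L n ω ∂μ ≤ ∫⁻ ω, L m ω ∂μ := by
    intro n hn
    induction n, hn using Nat.le_induction with
    | base =>
      have : W m = Set.univ := Set.eq_univ_of_forall fun ω k hk hkm => absurd hk hkm.not_ge
      simp [this]
    | succ n hn ih =>
      have hV : MeasurableSet {ω | L n ω < c} :=
        ℱ.le n _ (measurableSet_lt (hL n hn) measurable_const)
      have hcompl : (W (n + 1))ᶜ ⊆ (W n)ᶜ ∪ (W n \ {ω | L n ω < c}) := by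
        rw [hWsucc n hn]
        intro ω hω
        by_cases h : ω ∈ W n
        · exact .inr ⟨h, fun h' => hω ⟨h, h'⟩⟩
        · exact .inl h
      have hdiff : c * μ (W n \ {ω | L n ω < c}) ≤ ∫⁻ ω in W n \ {ω | L n ω < c}, L n ω ∂μ := by
        rw [← setLIntegral_const]
        exact setLIntegral_mono ((hL n hn).mono (ℱ.le n) le_rfl) fun ω hω => not_lt.1 hω.2
      calc c * μ (W (n + 1))ᶜ + ∫⁻ ω in W (n + 1), L (n + 1) ω ∂μ
          ≤ (c * μ (W n)ᶜ + c * μ (W n \ {ω | L n ω < c})) + ∫⁻ ω in W (n + 1), L n ω ∂μ := by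
            rw [← mul_add]
            gcongr ?_ + ?_
            · gcongr
              exact (measure_mono hcompl).trans (measure_union_le _ _)
            · exact hstep n hn _ (hWmeas n)
        _ ≤ c * μ (W n)ᶜ + (∫⁻ ω in W n ∩ {ω | L n ω < c}, L n ω ∂μ +
              ∫⁻ ω in W n \ {ω | L n ω < c}, L n ω ∂μ) := by
            rw [add_assoc, add_comm (c * μ (W n \ _)), hWsucc n hn]
            gcongr
        _ = c * μ (W n)ᶜ + ∫⁻ ω in W n, L n ω ∂μ := by
            rw [lintegral_inter_add_sdiff _ _ hV]
        _ ≤ _ := ih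
  have hunion : {ω | ∃ n, m ≤ n ∧ c ≤ L n ω} = ⋃ n, (W n)ᶜ := by
    ext ω
    simp only [hW, Set.mem_ofPred_eq, Set.mem_iUnion, Set.mem_compl_iff, not_forall, not_lt,
      exists_prop]
    exact ⟨fun ⟨n, hn, h⟩ => ⟨n + 1, n, hn, n.lt_succ_self, h⟩,
      fun ⟨_, k, hk, _, h⟩ => ⟨k, hk, h⟩⟩
  have hmono : Monotone fun n => (W n)ᶜ := fun a b hab =>
    Set.compl_subset_compl.2 fun ω h k hk hka => h k hk (hka.trans_le hab)
  rw [hunion, hmono.measure_iUnion, ENNReal.mul_iSup]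
  refine iSup_le fun n => ?_
  calc c * μ (W n)ᶜ ≤ c * μ (W (max n m))ᶜ :=
        mul_le_mul_right (measure_mono (hmono (le_max_left n m))) c
    _ ≤ _ := le_self_add.trans (hbound _ (le_max_right n m))

/-! ### Conditional exponential moments and second moments -/

/-- Pulling out an arbitrary `m`-measurable weight, bounded or not: the densities `f` and `μ[f | m]` define
the same measure on `m`. -/
theorem lintegral_mul_ofReal_condExp {Ω : Type*} {m mΩ : MeasurableSpace Ω} {μ : Measure Ω}
    (hm : m ≤ mΩ) [SigmaFinite (μ.trim hm)] {f : Ω → ℝ} (hf : Integrable f μ) (hf0 : 0 ≤ᵐ[μ] f)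
    {W : Ω → ENNReal} (hW : Measurable[m] W) :
    ∫⁻ ω, W ω * ENNReal.ofReal (f ω) ∂μ = ∫⁻ ω, W ω * ENNReal.ofReal (μ[f | m] ω) ∂μ := by
  have hf1 : AEMeasurable (fun ω => ENNReal.ofReal (f ω)) μ := hf.aemeasurable.ennreal_ofReal
  have hf2 : AEMeasurable (fun ω => ENNReal.ofReal (μ[f | m] ω)) μ :=
    integrable_condExp.aemeasurable.ennreal_ofReal
  have htrim : (μ.withDensity fun ω => ENNReal.ofReal (f ω)).trim hm =
      (μ.withDensity fun ω => ENNReal.ofReal (μ[f | m] ω)).trim hm := by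
    refine @Measure.ext _ m _ _ fun s hs => ?_
    rw [trim_measurableSet_eq hm hs, trim_measurableSet_eq hm hs, withDensity_apply _ (hm s hs),
      withDensity_apply _ (hm s hs), ← setLIntegral_condLExp hm μ _ hs]
    exact lintegral_congr_ae (ae_restrict_of_ae (condLExp_ofReal m hf hf0))
  have hWm := hW.mono hm le_rfl
  calc _ = ∫⁻ ω, W ω ∂(μ.withDensity fun ω => ENNReal.ofReal (f ω)) := by
        rw [lintegral_withDensity_eq_lintegral_mul₀ hf1 hWm.aemeasurable]
        simp [mul_comm]
    _ = ∫⁻ ω, W ω ∂(μ.withDensity fun ω => ENNReal.ofReal (μ[f | m] ω)) := by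
        rw [← lintegral_trim hm hW, htrim, lintegral_trim hm hW]
    _ = _ := by
        rw [lintegral_withDensity_eq_lintegral_mul₀ hf2 hWm.aemeasurable]
        simp [mul_comm]

/-- If `|Y| ≤ 1` has zero conditional mean and conditional variance `v`, then `exp (Y - v)` has conditional
mean at most `1`, because `exp y ≤ 1 + y + y²` for `|y| ≤ 1` and `1 + v ≤ exp v`. -/
theorem lintegral_mul_exp_sub_condVar_le {Ω : Type*} {m mΩ : MeasurableSpace Ω} {μ : Measure Ω}
    [IsFiniteMeasure μ] (hm : m ≤ mΩ) {Y v : Ω → ℝ} (hY : AEStronglyMeasurable Y μ)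
    (hY1 : ∀ᵐ ω ∂μ, |Y ω| ≤ 1) (hY0 : μ[Y | m] =ᵐ[μ] 0)
    (hv : Measurable[m] v) (hYv : μ[Y ^ 2 | m] =ᵐ[μ] v) {W : Ω → ENNReal} (hW : Measurable[m] W) :
    ∫⁻ ω, W ω * ENNReal.ofReal (Real.exp (Y ω - v ω)) ∂μ ≤ ∫⁻ ω, W ω ∂μ := by
  have hYi : Integrable Y μ := .of_bound hY 1 hY1
  have hY2i : Integrable (Y ^ 2) μ := .of_bound (hY.pow 2) 1 <| by
    filter_upwards [hY1] with ω h
    simpa [abs_le_one_iff_mul_self_le_one, sq] using h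
  have hei : Integrable (fun ω => Real.exp (Y ω)) μ :=
    .of_bound (Real.continuous_exp.comp_aestronglyMeasurable hY) (Real.exp 1) <| by
      filter_upwards [hY1] with ω h
      simpa using (le_abs_self _).trans h
  have hle : μ[fun ω => Real.exp (Y ω) | m] ≤ᵐ[μ] fun ω => 1 + v ω := by
    have h1 : μ[fun ω => Real.exp (Y ω) | m] ≤ᵐ[μ] μ[(fun _ => (1 : ℝ)) + Y + Y ^ 2 | m] := by
      refine condExp_mono hei (((integrable_const 1).add hYi).add hY2i) ?_
      filter_upwards [hY1] with ω h
      have := (abs_le.1 (Real.abs_exp_sub_one_sub_id_le h)).2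
      simp only [Pi.add_apply, Pi.pow_apply]
      linarith
    filter_upwards [h1, condExp_add ((integrable_const (1 : ℝ)).add hYi) hY2i m,
      condExp_add (integrable_const (1 : ℝ)) hYi m, hY0, hYv] with ω h1 h2 h3 h4 h5
    rw [h2, Pi.add_apply, h3, Pi.add_apply, h4, h5, condExp_const hm] at h1
    simpa using h1
  have hWe : Measurable[m] fun ω => W ω * ENNReal.ofReal (Real.exp (-v ω)) :=
    hW.mul (Real.measurable_exp.comp hv.neg).ennreal_ofReal
  calc ∫⁻ ω, W ω * ENNReal.ofReal (Real.exp (Y ω - v ω)) ∂μ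
      = ∫⁻ ω, W ω * ENNReal.ofReal (Real.exp (-v ω)) * ENNReal.ofReal (Real.exp (Y ω)) ∂μ := by
        congr 1 with ω
        rw [mul_assoc, ← ENNReal.ofReal_mul (Real.exp_nonneg _), ← Real.exp_add, neg_add_eq_sub]
    _ = ∫⁻ ω, W ω * ENNReal.ofReal (Real.exp (-v ω)) *
          ENNReal.ofReal (μ[fun ω => Real.exp (Y ω) | m] ω) ∂μ :=
        lintegral_mul_ofReal_condExp hm hei (.of_forall fun ω => Real.exp_nonneg _) hWe
    _ ≤ ∫⁻ ω, W ω ∂μ := by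
        refine lintegral_mono_ae ?_
        filter_upwards [hle] with ω h
        rw [mul_assoc, ← ENNReal.ofReal_mul (Real.exp_nonneg _)]
        refine mul_le_of_le_one_right' (ENNReal.ofReal_le_one.2 ?_)
        calc _ ≤ Real.exp (-v ω) * Real.exp (v ω) := by
              gcongr
              exact h.trans (by linarith [Real.add_one_le_exp (v ω)])
          _ = 1 := by rw [← Real.exp_add]; simp

theorem condExp_dotProduct_eq_zero {Ω : Type*} {m mΩ : MeasurableSpace Ω} {μ : Measure Ω}
    [IsFiniteMeasure μ] {K : ℕ} {w e : Ω → Fin K → ℝ} {C D : ℝ}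
    (hw : ∀ k, StronglyMeasurable[m] fun ω => w ω k) (hwC : ∀ᵐ ω ∂μ, ∀ k, |w ω k| ≤ C)
    (hm : m ≤ mΩ) (he : Measurable e) (heD : ∀ᵐ ω ∂μ, ∀ k, |e ω k| ≤ D)
    (he0 : μ[e | m] =ᵐ[μ] 0) :
    μ[fun ω => w ω ⬝ᵥ e ω | m] =ᵐ[μ] 0 := by
  have hek : ∀ k, Integrable (fun ω => e ω k) μ := fun k =>
    .of_bound ((measurable_pi_apply k).comp he).aestronglyMeasurable D (heD.mono fun ω h => h k)
  have hwe : ∀ k, Integrable ((fun ω => w ω k) * fun ω => e ω k) μ := fun k =>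
    (hek k).bdd_mul ((hw k).mono hm).aestronglyMeasurable (c := C) (hwC.mono fun ω h => h k)
  have hek0 : ∀ k, μ[fun ω => e ω k | m] =ᵐ[μ] 0 := fun k => by
    filter_upwards [(ContinuousLinearMap.proj (R := ℝ) (φ := fun _ : Fin K => ℝ) k).comp_condExp_comm
      (m := m) (Integrable.of_eval hek), he0] with ω h h0
    exact h.symm.trans (by simp [h0])
  have hsum : (fun ω => w ω ⬝ᵥ e ω) = ∑ k, (fun ω => w ω k) * fun ω => e ω k := by
    ext ω; simp [dotProduct]
  rw [hsum]
  have h1 : ∀ᵐ ω ∂μ, ∀ k, μ[(fun ω => w ω k) * fun ω => e ω k | m] ω = 0 := by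
    refine ae_all_iff.2 fun k => ?_
    filter_upwards [condExp_mul_of_stronglyMeasurable_left (hw k) (hwe k) (hek k), hek0 k]
      with ω h h0
    simp [h, h0]
  filter_upwards [condExp_finsetSum (s := Finset.univ) (fun k _ => hwe k) m, h1] with ω h h1
  simp [h, h1]

theorem condExp_sq_dotProduct {Ω : Type*} {m mΩ : MeasurableSpace Ω} {μ : Measure Ω}
    [IsFiniteMeasure μ] {K : ℕ} {w e : Ω → Fin K → ℝ} {C D : ℝ}
    (hw : ∀ k, StronglyMeasurable[m] fun ω => w ω k) (hwC : ∀ᵐ ω ∂μ, ∀ k, |w ω k| ≤ C)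
    (hm : m ≤ mΩ) (he : Measurable e) (heD : ∀ᵐ ω ∂μ, ∀ k, |e ω k| ≤ D) :
    μ[(fun ω => w ω ⬝ᵥ e ω) ^ 2 | m] =ᵐ[μ] fun ω => w ω ⬝ᵥ (condCov μ m e ω *ᵥ w ω) := by
  have hee : ∀ p : Fin K × Fin K, Integrable (fun ω => e ω p.1 * e ω p.2) μ := fun p => by
    refine .of_bound (C := D * D) (((measurable_pi_apply p.1).comp he).mul
      ((measurable_pi_apply p.2).comp he)).aestronglyMeasurable (heD.mono fun ω h => ?_)
    rw [Real.norm_eq_abs, abs_mul]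
    exact mul_le_mul (h _) (h _) (abs_nonneg _) ((abs_nonneg _).trans (h p.1))
  have hww : ∀ p : Fin K × Fin K, StronglyMeasurable[m] fun ω => w ω p.1 * w ω p.2 :=
    fun p => (hw p.1).mul (hw p.2)
  have hwe : ∀ p : Fin K × Fin K,
      Integrable ((fun ω => w ω p.1 * w ω p.2) * fun ω => e ω p.1 * e ω p.2) μ := fun p => by
    refine (hee p).bdd_mul ((hww p).mono hm).aestronglyMeasurable (c := C * C)
      (hwC.mono fun ω h => ?_)
    rw [Real.norm_eq_abs, abs_mul]
    exact mul_le_mul (h _) (h _) (abs_nonneg _) ((abs_nonneg _).trans (h p.1))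
  have hsum : (fun ω => w ω ⬝ᵥ e ω) ^ 2 =
      ∑ p : Fin K × Fin K, (fun ω => w ω p.1 * w ω p.2) * fun ω => e ω p.1 * e ω p.2 := by
    ext ω
    simp only [Pi.pow_apply, dotProduct, sq, Finset.sum_mul_sum, Fintype.sum_prod_type,
      Finset.sum_apply, Pi.mul_apply]
    exact Finset.sum_congr rfl fun i _ => Finset.sum_congr rfl fun j _ => by ring
  rw [hsum]
  have h1 : ∀ᵐ ω ∂μ, ∀ p : Fin K × Fin K,
      μ[(fun ω => w ω p.1 * w ω p.2) * fun ω => e ω p.1 * e ω p.2 | m] ω =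
        w ω p.1 * w ω p.2 * condCov μ m e ω p.1 p.2 :=
    ae_all_iff.2 fun p => condExp_mul_of_stronglyMeasurable_left (hww p) (hwe p) (hee p)
  filter_upwards [condExp_finsetSum (s := Finset.univ) (fun p _ => hwe p) m, h1] with ω h h1
  rw [h]
  simp only [Finset.sum_apply, h1, dotProduct, Matrix.mulVec, Fintype.sum_prod_type,
    Finset.mul_sum]
  exact Finset.sum_congr rfl fun i _ => Finset.sum_congr rfl fun j _ => by ring

/-- Almost surely, the conditional second moment matrix is positive semidefinite. The exceptional null set
is made independent of the vector by testing on a countable dense set. -/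
theorem ae_forall_dotProduct_condCov_nonneg {Ω : Type*} {m mΩ : MeasurableSpace Ω} {μ : Measure Ω}
    [IsFiniteMeasure μ] (hm : m ≤ mΩ) {K : ℕ} {e : Ω → Fin K → ℝ} {D : ℝ} (he : Measurable e)
    (heD : ∀ᵐ ω ∂μ, ∀ k, |e ω k| ≤ D) :
    ∀ᵐ ω ∂μ, ∀ y, 0 ≤ y ⬝ᵥ (condCov μ m e ω *ᵥ y) := by
  have hdense : ∀ᵐ ω ∂μ, ∀ n, 0 ≤ TopologicalSpace.denseSeq (Fin K → ℝ) n ⬝ᵥ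
      (condCov μ m e ω *ᵥ TopologicalSpace.denseSeq (Fin K → ℝ) n) := by
    refine ae_all_iff.2 fun n => ?_
    set y := TopologicalSpace.denseSeq (Fin K → ℝ) n
    have h0 : 0 ≤ᵐ[μ] μ[(fun ω => y ⬝ᵥ e ω) ^ 2 | m] :=
      condExp_nonneg (.of_forall fun ω => sq_nonneg _)
    filter_upwards [h0, condExp_sq_dotProduct (w := fun _ => y) (C := ‖y‖)
      (fun k => stronglyMeasurable_const) (.of_forall fun _ => norm_le_pi_norm y) hm he heD]
      with ω h1 h2
    exact h2 ▸ h1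
  filter_upwards [hdense] with ω h y
  have hcl : IsClosed {y : Fin K → ℝ | 0 ≤ y ⬝ᵥ (condCov μ m e ω *ᵥ y)} :=
    isClosed_le (by fun_prop) (by fun_prop)
  have : closure (Set.range (TopologicalSpace.denseSeq (Fin K → ℝ))) ⊆
      {y : Fin K → ℝ | 0 ≤ y ⬝ᵥ (condCov μ m e ω *ᵥ y)} :=
    closure_minimal (Set.range_subset_iff.2 h) hcl
  exact this (TopologicalSpace.denseRange_denseSeq _ y)

/-- One step of the exponential supermartingale. The radius `1 / (2 * B)` makes `|ξᵀ x e| ≤ 1`: the entries of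
`xᵀ ξ` are at most `1 / 2` by Cauchy–Schwarz, and `e` has `ℓ¹` norm at most `2`. -/
theorem lintegral_mul_exp_sub_quadForm_le {Ω : Type*} {m mΩ : MeasurableSpace Ω} {μ : Measure Ω}
    [IsFiniteMeasure μ] (hm : m ≤ mΩ) {d K : ℕ} {x : Ω → Matrix (Fin d) (Fin K) ℝ}
    {e : Ω → Fin K → ℝ} {B : ℝ} (hB : 0 < B) (hx : ∀ i k, Measurable[m] fun ω => x ω i k)
    (hxB : ∀ᵐ ω ∂μ, ∀ k, ‖WithLp.toLp 2 (fun i => x ω i k)‖ ≤ B)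
    (he : Measurable e) (he0 : μ[e | m] =ᵐ[μ] 0) (he2 : ∀ᵐ ω ∂μ, ∑ k, |e ω k| ≤ 2)
    {ξ : Fin d → ℝ} (hξ : ξ ⬝ᵥ ξ ≤ (1 / (2 * B)) ^ 2) {W : Ω → ENNReal} (hW : Measurable[m] W) :
    ∫⁻ ω, W ω * ENNReal.ofReal (Real.exp (ξ ⬝ᵥ (x ω *ᵥ e ω) -
      ξ ⬝ᵥ ((x ω * condCov μ m e ω * (x ω)ᵀ) *ᵥ ξ))) ∂μ ≤ ∫⁻ ω, W ω ∂μ := by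
  set w : Ω → Fin K → ℝ := fun ω => (x ω)ᵀ *ᵥ ξ with hw
  have hY : ∀ ω, ξ ⬝ᵥ (x ω *ᵥ e ω) = w ω ⬝ᵥ e ω := fun ω => by
    simp only [hw, Matrix.dotProduct_mulVec, Matrix.mulVec_transpose]
  have hv : ∀ ω, ξ ⬝ᵥ ((x ω * condCov μ m e ω * (x ω)ᵀ) *ᵥ ξ) =
      w ω ⬝ᵥ (condCov μ m e ω *ᵥ w ω) := fun ω => by
    rw [← Matrix.mulVec_mulVec, ← Matrix.mulVec_mulVec, Matrix.dotProduct_mulVec ξ]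
    simp only [hw, Matrix.mulVec_transpose]
  have hwm : ∀ k, Measurable[m] fun ω => w ω k := fun k => by
    simp only [hw, Matrix.mulVec, dotProduct, Matrix.transpose_apply]
    exact Finset.measurable_fun_sum _ fun i _ => (hx i k).mul_const _
  have hwC : ∀ᵐ ω ∂μ, ∀ k, |w ω k| ≤ 1 / 2 := by
    filter_upwards [hxB] with ω h k
    have h1 : ∑ i, x ω i k ^ 2 ≤ B ^ 2 := by
      have := pow_le_pow_left₀ (norm_nonneg _) (h k) 2
      rwa [EuclideanSpace.real_norm_sq_eq] at this
    have h2 : ∑ i, ξ i ^ 2 ≤ (1 / (2 * B)) ^ 2 := by simpa [dotProduct, sq] using hξ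
    refine abs_le_of_sq_le_sq ?_ (by norm_num)
    calc w ω k ^ 2 = (∑ i, x ω i k * ξ i) ^ 2 := by
          simp [hw, Matrix.mulVec, dotProduct]
      _ ≤ (∑ i, x ω i k ^ 2) * ∑ i, ξ i ^ 2 := Finset.sum_mul_sq_le_sq_mul_sq _ _ _
      _ ≤ B ^ 2 * (1 / (2 * B)) ^ 2 := by gcongr
      _ = (1 / 2) ^ 2 := by field_simp
  have he2' : ∀ᵐ ω ∂μ, ∀ k, |e ω k| ≤ 2 := he2.mono fun ω h k =>
    (Finset.single_le_sum (f := fun k => |e ω k|) (fun _ _ => abs_nonneg _)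
      (Finset.mem_univ k)).trans h
  have hws : ∀ k, StronglyMeasurable[m] fun ω => w ω k := fun k => (hwm k).stronglyMeasurable
  simp only [hY, hv]
  refine lintegral_mul_exp_sub_condVar_le hm ?_ ?_
    (condExp_dotProduct_eq_zero hws hwC hm he he2' he0) ?_ (condExp_sq_dotProduct hws hwC hm he he2') hW
  · refine Measurable.aestronglyMeasurable ?_
    simp only [dotProduct]
    exact Finset.measurable_fun_sum _ fun k _ =>
      ((hwm k).mono hm le_rfl).mul ((measurable_pi_apply k).comp he)
  · filter_upwards [hwC, he2] with ω h1 h2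
    calc |w ω ⬝ᵥ e ω| ≤ ∑ k, |w ω k * e ω k| := Finset.abs_sum_le_sum_abs _ _
      _ ≤ ∑ k, 1 / 2 * |e ω k| := by
          gcongr with k
          rw [abs_mul]
          exact mul_le_mul_of_nonneg_right (h1 k) (abs_nonneg _)
      _ ≤ 1 := by rw [← Finset.mul_sum]; linarith
  · simp only [dotProduct, Matrix.mulVec]
    exact Finset.measurable_fun_sum _ fun i _ => (hwm i).mul <|
      Finset.measurable_fun_sum _ fun j _ =>
        (stronglyMeasurable_condExp.measurable : Measurable[m] _).mul (hwm j)

/-! ### The mixture supermartingale -/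

/-- The mixture over the ball of radius `r` of the exponentials `exp (ξᵀ S - ξᵀ H ξ)`, with respect to
Lebesgue measure and not normalized. When `H` contains the regularizer `H₀`, the factor
`exp (-ξᵀ H₀ ξ)` plays the role of a truncated Gaussian prior. -/
noncomputable def expQuadMixture {d : ℕ} (r : ℝ) (H : Matrix (Fin d) (Fin d) ℝ) (S : Fin d → ℝ) :
    ENNReal :=
  ∫⁻ ξ in {ξ : Fin d → ℝ | ξ ⬝ᵥ ξ ≤ r ^ 2}, ENNReal.ofReal (Real.exp (ξ ⬝ᵥ S - ξ ⬝ᵥ (H *ᵥ ξ)))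

theorem measurable_ofReal_exp_sub_quadForm {Ω : Type*} {m : MeasurableSpace Ω} {d : ℕ}
    {H : Ω → Matrix (Fin d) (Fin d) ℝ} {S ξ : Ω → Fin d → ℝ}
    (hH : ∀ i j, Measurable fun ω => H ω i j) (hS : ∀ i, Measurable fun ω => S ω i)
    (hξ : ∀ i, Measurable fun ω => ξ ω i) :
    Measurable fun ω => ENNReal.ofReal (Real.exp (ξ ω ⬝ᵥ S ω - ξ ω ⬝ᵥ (H ω *ᵥ ξ ω))) := by
  refine (Real.measurable_exp.comp ?_).ennreal_ofReal
  simp only [dotProduct, Matrix.mulVec]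
  exact (Finset.measurable_fun_sum _ fun i _ => (hξ i).mul (hS i)).sub
    (Finset.measurable_fun_sum _ fun i _ => (hξ i).mul
      (Finset.measurable_fun_sum _ fun j _ => (hH i j).mul (hξ j)))

theorem measurable_uncurry_ofReal_exp_sub_quadForm {Ω : Type*} {m : MeasurableSpace Ω} {d : ℕ}
    {H : Ω → Matrix (Fin d) (Fin d) ℝ} {S : Ω → Fin d → ℝ}
    (hH : ∀ i j, Measurable fun ω => H ω i j) (hS : ∀ i, Measurable fun ω => S ω i) :
    Measurable (Function.uncurry fun ω (ξ : Fin d → ℝ) =>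
      ENNReal.ofReal (Real.exp (ξ ⬝ᵥ S ω - ξ ⬝ᵥ (H ω *ᵥ ξ)))) :=
  measurable_ofReal_exp_sub_quadForm (H := fun p : Ω × (Fin d → ℝ) => H p.1)
    (S := fun p => S p.1) (ξ := fun p => p.2) (fun i j => (hH i j).comp measurable_fst)
    (fun i => (hS i).comp measurable_fst) fun i => (measurable_pi_apply i).comp measurable_snd

theorem measurable_expQuadMixture {Ω : Type*} {m : MeasurableSpace Ω} {d : ℕ} (r : ℝ)
    {H : Ω → Matrix (Fin d) (Fin d) ℝ} {S : Ω → Fin d → ℝ}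
    (hH : ∀ i j, Measurable fun ω => H ω i j) (hS : ∀ i, Measurable fun ω => S ω i) :
    Measurable fun ω => expQuadMixture r (H ω) (S ω) :=
  (measurable_uncurry_ofReal_exp_sub_quadForm hH hS).lintegral_prod_right'

theorem measurable_noiseSum_apply {Ω : Type*} {mΩ : MeasurableSpace Ω} {d K : ℕ}
    {ℱ : Filtration ℕ mΩ} {X : ℕ → Ω → Matrix (Fin d) (Fin K) ℝ} {ε : ℕ → Ω → Fin K → ℝ}
    (hX : ∀ t, 1 ≤ t → ∀ i k, Measurable[ℱ t] fun ω => X t ω i k)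
    (hε : ∀ t, 1 ≤ t → Measurable[ℱ (t + 1)] (ε t)) (t : ℕ) (i : Fin d) :
    Measurable[ℱ t] fun ω => noiseSum X ε t ω i := by
  simp only [noiseSum, Finset.sum_apply, Matrix.mulVec, dotProduct]
  refine Finset.measurable_fun_sum _ fun s hs => Finset.measurable_fun_sum _ fun k _ => ?_
  obtain ⟨hs1, hst⟩ := Finset.mem_Ico.1 hs
  exact ((hX s hs1 i k).mono (ℱ.mono hst.le) le_rfl).mul
    ((measurable_pi_apply k).comp ((hε s hs1).mono (ℱ.mono hst) le_rfl))

theorem measurable_infoMatrix_apply {Ω : Type*} {mΩ : MeasurableSpace Ω} {d K : ℕ}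
    {ℱ : Filtration ℕ mΩ} (H₀ : Matrix (Fin d) (Fin d) ℝ) {X : ℕ → Ω → Matrix (Fin d) (Fin K) ℝ}
    {Sig : ℕ → Ω → Matrix (Fin K) (Fin K) ℝ}
    (hX : ∀ t, 1 ≤ t → ∀ i k, Measurable[ℱ t] fun ω => X t ω i k)
    (hSig : ∀ t, 1 ≤ t → ∀ i k, Measurable[ℱ t] fun ω => Sig t ω i k) (t : ℕ) (i j : Fin d) :
    Measurable[ℱ t] fun ω => infoMatrix H₀ X Sig t ω i j := by
  simp only [infoMatrix, Matrix.add_apply, Matrix.sum_apply, Matrix.mul_apply,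
    Matrix.transpose_apply]
  refine Measurable.const_add (Finset.measurable_fun_sum _ fun s hs =>
    Finset.measurable_fun_sum _ fun k _ => ?_) _
  obtain ⟨hs1, hst⟩ := Finset.mem_Ico.1 hs
  have hXs : ∀ i k, Measurable[ℱ t] fun ω => X s ω i k := fun i k =>
    (hX s hs1 i k).mono (ℱ.mono hst.le) le_rfl
  exact (Finset.measurable_fun_sum _ fun l _ => (hXs i l).mul
    ((hSig s hs1 l k).mono (ℱ.mono hst.le) le_rfl)).mul (hXs j k)

/-- The mixture inherits the supermartingale property from each of its components, by Tonelli. -/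
theorem setLIntegral_expQuadMixture_succ_le {Ω : Type*} {mΩ : MeasurableSpace Ω} {μ : Measure Ω}
    [IsFiniteMeasure μ] {d K : ℕ} {ℱ : Filtration ℕ mΩ} {X : ℕ → Ω → Matrix (Fin d) (Fin K) ℝ}
    {ε : ℕ → Ω → Fin K → ℝ} (H₀ : Matrix (Fin d) (Fin d) ℝ) {B : ℝ} (hB : 0 < B)
    (hXmeas : ∀ t, 1 ≤ t → ∀ i k, Measurable[ℱ t] fun ω => X t ω i k)
    (hXB : ∀ t, 1 ≤ t → ∀ᵐ ω ∂μ, ∀ k, ‖WithLp.toLp 2 (fun i => X t ω i k)‖ ≤ B)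
    (hεmeas : ∀ t, 1 ≤ t → Measurable[ℱ (t + 1)] (ε t))
    (hεmean : ∀ t, 1 ≤ t → μ[ε t | ℱ t] =ᵐ[μ] 0)
    (hε : ∀ t, 1 ≤ t → ∀ᵐ ω ∂μ, ∑ k, |ε t ω k| ≤ 2) {t : ℕ} (ht : 1 ≤ t) {A : Set Ω}
    (hA : MeasurableSet[ℱ t] A) :
    ∫⁻ ω in A, expQuadMixture (1 / (2 * B))
        (infoMatrix H₀ X (fun s => condCov μ (ℱ s) (ε s)) (t + 1) ω) (noiseSum X ε (t + 1) ω) ∂μ ≤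
      ∫⁻ ω in A, expQuadMixture (1 / (2 * B))
        (infoMatrix H₀ X (fun s => condCov μ (ℱ s) (ε s)) t ω) (noiseSum X ε t ω) ∂μ := by
  set H := infoMatrix H₀ X (fun s => condCov μ (ℱ s) (ε s)) with hHdef
  set S := noiseSum X ε with hSdef
  set M : ℕ → Ω → (Fin d → ℝ) → ENNReal := fun t ω ξ =>
    ENNReal.ofReal (Real.exp (ξ ⬝ᵥ S t ω - ξ ⬝ᵥ (H t ω *ᵥ ξ))) with hM
  have hHm : ∀ t i j, Measurable[ℱ t] fun ω => H t ω i j :=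
    measurable_infoMatrix_apply H₀ hXmeas fun s _ i j => stronglyMeasurable_condExp.measurable
  have hSm : ∀ t i, Measurable[ℱ t] fun ω => S t ω i := measurable_noiseSum_apply hXmeas hεmeas
  have hMm : ∀ t, Measurable (Function.uncurry (M t)) := fun t =>
    measurable_uncurry_ofReal_exp_sub_quadForm (fun i j => (hHm t i j).mono (ℱ.le t) le_rfl)
      fun i => (hSm t i).mono (ℱ.le t) le_rfl
  have hMt : ∀ ξ, Measurable[ℱ t] fun ω => M t ω ξ := fun ξ =>
    measurable_ofReal_exp_sub_quadForm (ξ := fun _ => ξ) (hHm t) (hSm t) fun _ => measurable_const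
  have hms : MeasurableSet {w : Fin d → ℝ | w ⬝ᵥ w ≤ (1 / (2 * B)) ^ 2} :=
    (isClosed_le (by fun_prop) (by fun_prop)).measurableSet
  simp only [expQuadMixture]
  rw [lintegral_lintegral_swap (f := M (t + 1)) (hMm _).aemeasurable,
    lintegral_lintegral_swap (f := M t) (hMm _).aemeasurable]
  refine setLIntegral_mono' hms fun ξ hξ => ?_
  rw [← lintegral_indicator (ℱ.le t _ hA), ← lintegral_indicator (ℱ.le t _ hA)]
  refine le_trans (le_of_eq ?_) (lintegral_mul_exp_sub_quadForm_le (ℱ.le t) hB (hXmeas t ht)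
    (hXB t ht) ((hεmeas t ht).mono (ℱ.le _) le_rfl) (hεmean t ht) (hε t ht) hξ
    ((hMt ξ).indicator hA))
  congr 1 with ω
  by_cases hω : ω ∈ A
  · rw [Set.indicator_of_mem hω, Set.indicator_of_mem hω]
    simp only [hM]
    rw [← ENNReal.ofReal_mul (Real.exp_nonneg _), ← Real.exp_add]
    congr 2
    simp only [hHdef, hSdef, infoMatrix, noiseSum, Finset.sum_Ico_succ_top ht, ← add_assoc,
      Matrix.add_mulVec, dotProduct_add]
    ring
  · simp [Set.indicator_of_notMem hω]

/-! ### The self-normalized bound -/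

theorem isHermitian_infoMatrix_condCov {Ω : Type*} {mΩ : MeasurableSpace Ω} {μ : Measure Ω}
    {d K : ℕ} {ℱ : Filtration ℕ mΩ} {H₀ : Matrix (Fin d) (Fin d) ℝ} (hH₀ : H₀.IsHermitian)
    (X : ℕ → Ω → Matrix (Fin d) (Fin K) ℝ) (ε : ℕ → Ω → Fin K → ℝ) (t : ℕ) (ω : Ω) :
    (infoMatrix H₀ X (fun s => condCov μ (ℱ s) (ε s)) t ω).IsHermitian := by
  refine hH₀.add ?_
  rw [Matrix.IsHermitian, Matrix.conjTranspose_sum]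
  refine Finset.sum_congr rfl fun s _ => ?_
  have hC : (condCov μ (ℱ s) (ε s) ω).IsHermitian := by
    ext i j
    simp [condCov, mul_comm]
  have := Matrix.isHermitian_mul_mul_conjTranspose (X s ω) hC
  rwa [Matrix.conjTranspose_eq_transpose_of_trivial] at this

theorem mul_dotProduct_self_le_infoMatrix {Ω : Type*} {d K : ℕ} {H₀ : Matrix (Fin d) (Fin d) ℝ}
    {c : ℝ} (hH₀ : ∀ u, c * (u ⬝ᵥ u) ≤ u ⬝ᵥ (H₀ *ᵥ u)) (X : ℕ → Ω → Matrix (Fin d) (Fin K) ℝ)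
    {Sig : ℕ → Ω → Matrix (Fin K) (Fin K) ℝ} {ω : Ω}
    (hSig : ∀ s, 1 ≤ s → ∀ y, 0 ≤ y ⬝ᵥ (Sig s ω *ᵥ y)) (t : ℕ) (u : Fin d → ℝ) :
    c * (u ⬝ᵥ u) ≤ u ⬝ᵥ (infoMatrix H₀ X Sig t ω *ᵥ u) := by
  rw [infoMatrix, Matrix.add_mulVec, dotProduct_add, Matrix.sum_mulVec, dotProduct_sum]
  refine le_add_of_le_of_nonneg (hH₀ u) (Finset.sum_nonneg fun s hs => ?_)
  rw [← Matrix.mulVec_mulVec, ← Matrix.mulVec_mulVec, Matrix.dotProduct_mulVec u,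
    ← Matrix.mulVec_transpose]
  exact hSig s (Finset.mem_Ico.1 hs).1 _

/-- Taking logarithms in the lower bound for the mixture at radius `1 / (2 * B)`, for which the scale
`a = r √lam / 2` is `√lam / (4 * B)`. -/
theorem le_add_log_of_exp_mul_lt {d : ℕ} {lam B δ D T : ℝ} (hlam : 0 < lam) (hB : 0 < B)
    (hδ : 0 < δ) (hD : 0 < D)
    (h : Real.exp (1 / (2 * B) * √lam / 2 * T - (1 / (2 * B) * √lam / 2) ^ 2) *
      ((√lam / 2) ^ d / √D) < δ⁻¹) :
    T ≤ √lam / (4 * B) + 4 * B / √lam * Real.log (√D / (δ * lam ^ ((d : ℝ) / 2))) +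
      4 * B / √lam * d * Real.log 2 := by
  have hs : 0 < √lam := Real.sqrt_pos.2 hlam
  have hsD : 0 < √D := Real.sqrt_pos.2 hD
  have hpow : lam ^ ((d : ℝ) / 2) = √lam ^ d := by
    rw [Real.sqrt_eq_rpow, ← Real.rpow_natCast, ← Real.rpow_mul hlam.le]
    congr 1; ring
  have ha : 1 / (2 * B) * √lam / 2 = √lam / (4 * B) := by field_simp; norm_num
  rw [ha] at h
  have hlog := Real.log_lt_log (by positivity) h
  rw [Real.log_mul (by positivity) (by positivity), Real.log_exp, Real.log_div (by positivity)
    hsD.ne', Real.log_pow, Real.log_div hs.ne' (by norm_num), Real.log_inv] at hlog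
  rw [hpow, Real.log_div hsD.ne' (by positivity), Real.log_mul hδ.ne' (by positivity),
    Real.log_pow]
  set a := √lam / (4 * B) with hadef
  have ha0 : 0 < a := by positivity
  have hainv : 4 * B / √lam = a⁻¹ := by rw [hadef, inv_div]
  rw [hainv]
  refine le_of_mul_le_mul_left ?_ ha0
  calc a * T ≤ a ^ 2 + (Real.log √D - (Real.log δ + d * Real.log √lam)) + d * Real.log 2 := by
        linarith
    _ = _ := by field_simp

theorem theorem4 {Ω : Type*} {mΩ : MeasurableSpace Ω} (μ : Measure Ω) [IsProbabilityMeasure μ]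
    {d K : ℕ} (ℱ : Filtration ℕ mΩ)
    (X : ℕ → Ω → Matrix (Fin d) (Fin K) ℝ) (ε : ℕ → Ω → Fin K → ℝ)
    (Sig : ℕ → Ω → Matrix (Fin K) (Fin K) ℝ)
    (H₀ : Matrix (Fin d) (Fin d) ℝ) (lam B : ℝ) (hlam : 0 < lam) (hB : 0 < B)
    -- `X_t` is `ℱ_t`-measurable, with columns of Euclidean norm at most `B`
    (hXmeas : ∀ t, 1 ≤ t → ∀ i k, Measurable[ℱ t] fun ω => X t ω i k)
    (hXB : ∀ t, 1 ≤ t → ∀ᵐ ω ∂μ, ∀ k, ‖WithLp.toLp 2 (fun i => X t ω i k)‖ ≤ B)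
    -- `ε_t` is a martingale difference sequence with `ε_t` being `ℱ_{t+1}`-measurable
    (hεmeas : ∀ t, 1 ≤ t → Measurable[ℱ (t + 1)] (ε t))
    (hεmean : ∀ t, 1 ≤ t → μ[ε t | ℱ t] =ᵐ[μ] 0)
    (hε : ∀ t, 1 ≤ t → ∀ᵐ ω ∂μ, ∑ k, |ε t ω k| ≤ 2)
    -- `Sig t` is any version of the conditional covariance
    (hSig : ∀ t, 1 ≤ t → Sig t =ᵐ[μ] condCov μ (ℱ t) (ε t))
    -- the smallest eigenvalue of the symmetric matrix `H₀` exceeds `lam`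
    (hH₀ : H₀.IsHermitian) (hH₀lam : ∀ i, lam < hH₀.eigenvalues i)
    (δ : ℝ) (hδ : 0 < δ) (hδ1 : δ ≤ 1) :
    ENNReal.ofReal (1 - δ) ≤ μ {ω | ∀ t, 1 ≤ t →
      weightedNorm (infoMatrix H₀ X Sig t ω)⁻¹ (noiseSum X ε t ω) ≤
        Real.sqrt lam / (4 * B)
          + 4 * B / Real.sqrt lam *
            Real.log (Real.sqrt (infoMatrix H₀ X Sig t ω).det / (δ * lam ^ ((d : ℝ) / 2)))
          + 4 * B / Real.sqrt lam * d * Real.log 2} := by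
  have hH₀le : ∀ u, lam * (u ⬝ᵥ u) ≤ u ⬝ᵥ (H₀ *ᵥ u) :=
    hH₀.mul_dotProduct_self_le fun i => (hH₀lam i).le
  set r : ℝ := 1 / (2 * B) with hr
  have hr0 : 0 < r := by positivity
  set H := infoMatrix H₀ X (fun s => condCov μ (ℱ s) (ε s)) with hH
  set L : ℕ → Ω → ENNReal := fun t ω => expQuadMixture r (H t ω) (noiseSum X ε t ω) with hL
  -- The unnormalized mass of the isotropic prior, which dominates the initial mixture.
  set N := ∫⁻ w in {w : Fin d → ℝ | w ⬝ᵥ w ≤ r ^ 2},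
    ENNReal.ofReal (Real.exp (-(lam * (w ⬝ᵥ w)))) with hN
  have hN0 : N ≠ 0 := (lintegral_exp_neg_dotProduct_pos lam hr0).ne'
  have hNtop : N ≠ ⊤ := lintegral_exp_neg_dotProduct_ne_top hlam.le r
  have hL1 : ∫⁻ ω, L 1 ω ∂μ ≤ N := by
    have : ∀ ω, L 1 ω ≤ N := fun ω => by
      simp only [hL, expQuadMixture, hH, infoMatrix, noiseSum, Finset.Ico_self, Finset.sum_empty,
        add_zero, dotProduct_zero, zero_sub]
      refine lintegral_mono fun ξ => ?_
      gcongr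
      exact hH₀le ξ
    calc _ ≤ ∫⁻ _, N ∂μ := lintegral_mono this
      _ = N := by simp
  have hville := (mul_measure_exists_le_le_lintegral (L := L) (m := 1) (ℱ := ℱ)
    (fun n _ => measurable_expQuadMixture r (measurable_infoMatrix_apply H₀ hXmeas
      (fun s _ i j => stronglyMeasurable_condExp.measurable) n)
      (measurable_noiseSum_apply hXmeas hεmeas n))
    (fun n hn A hA => setLIntegral_expQuadMixture_succ_le H₀ hB hXmeas hXB hεmeas hεmean hε hn hA)
    (ENNReal.ofReal δ⁻¹ * N)).trans hL1
  set bad := {ω | ∃ n, 1 ≤ n ∧ ENNReal.ofReal δ⁻¹ * N ≤ L n ω} with hbad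
  have hbadδ : μ bad ≤ ENNReal.ofReal δ := by
    rw [mul_right_comm] at hville
    have h1 : ENNReal.ofReal δ⁻¹ * μ bad ≤ 1 := by
      rw [← ENNReal.mul_le_mul_iff_left hN0 hNtop, one_mul]
      exact hville
    rw [ENNReal.ofReal_inv_of_pos hδ] at h1
    rwa [ENNReal.inv_mul_le_iff (by simpa using hδ) ENNReal.ofReal_ne_top, mul_one] at h1
  have hgood : ENNReal.ofReal (1 - δ) ≤ μ badᶜ := by
    rw [ENNReal.ofReal_sub _ hδ.le, ENNReal.ofReal_one, tsub_le_iff_left]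
    calc 1 = μ Set.univ := measure_univ.symm
      _ ≤ μ bad + μ badᶜ := by rw [← Set.union_compl_self bad]; exact measure_union_le _ _
      _ ≤ _ := by gcongr
  refine hgood.trans (measure_mono_ae ?_)
  -- `Sig` need not be measurable, so the argument runs with `condCov` and transfers at the end.
  have hSig' : ∀ᵐ ω ∂μ, ∀ t, 1 ≤ t → Sig t ω = condCov μ (ℱ t) (ε t) ω :=
    ae_all_iff.2 fun t => eventually_imp_distrib_left.2 (hSig t)
  have hpsd : ∀ᵐ ω ∂μ, ∀ t, 1 ≤ t → ∀ y, 0 ≤ y ⬝ᵥ (condCov μ (ℱ t) (ε t) ω *ᵥ y) := by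
    refine ae_all_iff.2 fun t => eventually_imp_distrib_left.2 fun ht => ?_
    refine ae_forall_dotProduct_condCov_nonneg (D := 2) (ℱ.le t)
      ((hεmeas t ht).mono (ℱ.le _) le_rfl) ?_
    exact (hε t ht).mono fun ω h k =>
      (Finset.single_le_sum (f := fun k => |ε t ω k|) (fun _ _ => abs_nonneg _)
        (Finset.mem_univ k)).trans h
  filter_upwards [hSig', hpsd] with ω hω hωpsd hωgood t ht
  have hHeq : infoMatrix H₀ X Sig t ω = H t ω := by
    simp only [hH, infoMatrix]
    congr 1
    exact Finset.sum_congr rfl fun s hs => by rw [hω s (Finset.mem_Ico.1 hs).1]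
  rw [hHeq]
  have hherm : (H t ω).IsHermitian := isHermitian_infoMatrix_condCov hH₀ X ε t ω
  have hle := mul_dotProduct_self_le_infoMatrix hH₀le X hωpsd t
  have hlt : L t ω < ENNReal.ofReal δ⁻¹ * N := not_le.1 fun h => hωgood ⟨t, ht, h⟩
  have hlow := hherm.exp_weightedNorm_inv_mul_lintegral_le (r := r) hlam hle (noiseSum X ε t ω)
  have h := hlow.trans_lt hlt
  rw [ENNReal.mul_lt_mul_iff_left hN0 hNtop, ENNReal.ofReal_lt_ofReal_iff (by positivity)] at h
  exact le_add_log_of_exp_mul_lt hlam hB hδ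
    (hherm.posDef_of_mul_dotProduct_self_le hlam hle).det_pos h
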